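/- Let $g,l,m,I>0$. Let $s:[0,\infty)\to\mathbb R$ be smooth and increasing with $s(0)=0$, let $M:(0,\pi/2)\to\mathbb R$ be smooth and decreasing, and let $h:\mathbb R\to\mathbb R$ be continuous, increasing, differentiable at $0$, with $h(0)=0$ (here "increasing" and "decreasing" may be understood in the weak sense). For $F\in\mathbb R$ consider the general Watt governor system $$\varphi'=\psi,\qquad \psi'=s(\Omega)^2\sin\varphi\cos\varphi-\frac gl\sin\varphi-\frac1m h(\psi),\qquad \Omega'=\frac1I\bigl(M(\varphi)-F\bigr)$$ on the state space $\varphi\in(0,\pi/2)$, $\psi\in\mathbb R$, $\Omega\in[0,\infty)$. Let $P_0=(\varphi_0,0,\Omega_0)$ be an equilibrium point of the system in this state space, and assume $s'(\Omega_0)>0$ and $M'(\varphi_0)<0$. (a) If $\displaystyle h'(0)>-\frac{2m}{I}\,\frac{s'(\Omega_0)}{s(\Omega_0)}\,M'(\varphi_0)\cot\varphi_0$, then $P_0$ is asymptotically stable: it is Lyapunov stable, and from every initial point sufficiently close to $P_0$ there starts a solution defined for all $t\ge 0$, and every such solution converges to $P_0$. (b) If $\displaystyle 0<h'(0)<-\frac{2m}{I}\,\frac{s'(\Omega_0)}{s(\Omega_0)}\,M'(\varphi_0)\cot\varphi_0$,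 then $P_0$ is unstable, that is, not Lyapunov stable. (c) For loads $\tilde F$ near $F$ there are equilibria $(\varphi(\tilde F),0,\Omega(\tilde F))$ with $\varphi(F)=\varphi_0$, $\Omega(F)=\Omega_0$. For every such family, $\tilde F\mapsto\Omega(\tilde F)$ is differentiable at $F$, and the non-uniformity of performance $\eta=\left|\frac{d\Omega}{d\tilde F}(F)\right|$ equals $$\eta=-\frac{s(\Omega_0)}{2M'(\varphi_0)s'(\Omega_0)}\tan\varphi_0 .$$ The inequality in (a) holds if and only if the generalized Vyshnegradskii condition $\dfrac{h'(0)\,I}{m}\,\eta>1$ holds. -/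

import Mathlib

open Filter Topology Set
open scoped ContDiff

noncomputable section

/-! ### Solutions and stability for an autonomous equation `x' = f x` on a set `D` -/

section Stability

variable {E : Type*} [NormedAddCommGroup E] [NormedSpace ℝ E]

/-- `γ` restricted to the time interval `J` is a solution of `x' = f x` with values in `D`
(one-sided derivatives at the end points of `J`). -/
def IsSolutionOn (f : E → E) (D : Set E) (γ : ℝ → E) (J : Set ℝ) : Prop :=
  (∀ t ∈ J, γ t ∈ D) ∧ IsIntegralCurveOn γ (fun _ => f) J

/-- The point `p` of `D` is an equilibrium of `x' = f x`. -/
def IsEquilibrium (f : E → E) (D : Set E) (p : E) : Prop :=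
  p ∈ D ∧ f p = 0

/-- Stability in the sense of Lyapunov: for every `ε > 0` there is `δ > 0` such that every solution
on a time interval `[0, T]` that starts at distance less than `δ` from `p` stays at distance less
than `ε` from `p`. -/
def IsLyapunovStable (f : E → E) (D : Set E) (p : E) : Prop :=
  ∀ ε > 0, ∃ δ > 0, ∀ T > 0, ∀ γ : ℝ → E, IsSolutionOn f D γ (Icc 0 T) →
    dist (γ 0) p < δ → ∀ t ∈ Icc 0 T, dist (γ t) p < ε

/-- Asymptotic stability: `p` is an equilibrium, it is Lyapunov stable, and from every initial
point close enough to `p` there starts a solution for all times `t ≥ 0`, each such solution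
converging to `p`. -/
def IsAsymptoticallyStable (f : E → E) (D : Set E) (p : E) : Prop :=
  IsEquilibrium f D p ∧ IsLyapunovStable f D p ∧
    ∃ δ > 0, ∀ x₀ ∈ D, dist x₀ p < δ →
      (∃ γ : ℝ → E, IsSolutionOn f D γ (Ici 0) ∧ γ 0 = x₀) ∧
      ∀ γ : ℝ → E, IsSolutionOn f D γ (Ici 0) → γ 0 = x₀ → Tendsto γ atTop (𝓝 p)

/-- An equilibrium is unstable if it is not Lyapunov stable. -/
def IsUnstable (f : E → E) (D : Set E) (p : E) : Prop :=
  IsEquilibrium f D p ∧ ¬ IsLyapunovStable f D p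

end Stability

/-! ### The general Watt governor system -/

/-- The data of a general Watt governor system. -/
structure WattGovernor where
  /-- acceleration of gravity -/
  g : ℝ
  /-- length of the arms -/
  l : ℝ
  /-- mass of each ball -/
  m : ℝ
  /-- moment of inertia of the flywheel -/
  I : ℝ
  /-- transmission function, relevant on `[0, ∞)` -/
  s : ℝ → ℝ
  /-- frictional force -/
  h : ℝ → ℝ
  /-- torque function of the steam supply, relevant on `(0, π/2)` -/
  M : ℝ → ℝ
  g_pos : 0 < g
  l_pos : 0 < l
  m_pos : 0 < m
  I_pos : 0 < I
  s_smooth : ContDiffOn ℝ ∞ s (Ici 0)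
  s_mono : MonotoneOn s (Ici 0)
  s_zero : s 0 = 0
  h_cont : Continuous h
  h_diff : DifferentiableAt ℝ h 0
  h_mono : Monotone h
  h_zero : h 0 = 0
  M_smooth : ContDiffOn ℝ ∞ M (Ioo 0 (Real.pi / 2))
  M_anti : AntitoneOn M (Ioo 0 (Real.pi / 2))

namespace WattGovernor

/-- The state space of triples `(φ, ψ, Ω)` with `φ ∈ (0, π/2)`, `ψ ∈ ℝ`, `Ω ∈ [0, ∞)`. -/
def stateSpace : Set (ℝ × ℝ × ℝ) :=
  {x | x.1 ∈ Ioo 0 (Real.pi / 2) ∧ 0 ≤ x.2.2}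

/-- The vector field of the system under the load torque `F`, at `x = (φ, ψ, Ω)`. -/
def field (G : WattGovernor) (F : ℝ) (x : ℝ × ℝ × ℝ) : ℝ × ℝ × ℝ :=
  (x.2.1,
   (G.s x.2.2) ^ 2 * Real.sin x.1 * Real.cos x.1 - G.g / G.l * Real.sin x.1 - 1 / G.m * G.h x.2.1,
   1 / G.I * (G.M x.1 - F))

/-- The critical value of the damping `h'(0)` for the equilibrium `(φ₀, 0, Ω₀)`. -/
def criticalDamping (G : WattGovernor) (φ₀ Ω₀ : ℝ) : ℝ :=
  -(2 * G.m / G.I) * (deriv G.s Ω₀ / G.s Ω₀) * deriv G.M φ₀ * Real.cot φ₀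

/-- `F ↦ (Φ F, 0, W F)` is a branch of equilibria, parametrized by the load `F` near `F₀`, through
the point `(φ₀, 0, Ω₀)`. No regularity of `Φ` and `W` is required. -/
def IsEquilibriumBranch (G : WattGovernor) (F₀ φ₀ Ω₀ : ℝ) (Φ W : ℝ → ℝ) : Prop :=
  Φ F₀ = φ₀ ∧ W F₀ = Ω₀ ∧
    ∀ᶠ F in 𝓝 F₀, IsEquilibrium (G.field F) stateSpace (Φ F, 0, W F)

end WattGovernor

end

/-! At an equilibrium the linearization is x' = y, y' = -a x - b y + c z, z' = -d x with a, c, d >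
0, and the damping condition in (a) is the Hurwitz inequality c d < a b (`hurwitz_sub_eq`). Instead
of eigenvalues, one explicit quadratic form V serves both stability statements. Its main part has
derivative -(ab - cd) y² along the linear flow, and a small multiple of a second form makes this
derivative definite (`governorBilin_lieDeriv`). If c d < a b, then V is positive definite and
decays, so `isAsymptoticallyStable_of_bilin` applies. If c d > a b, the opposite correction makes V
grow while it is positive somewhere, so `isUnstable_of_bilin` applies.

Since `h` is only continuous away from 0, the field need not be locally Lipschitz. Solutions come
from Peano's theorem, and the stability estimates never use uniqueness.

For (c), the equilibrium equations are M(φ) = F and s(Ω)² cos φ = g/l. Monotonicity of `M` and `s`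
forces any branch to be continuous at the base load (`MonotoneOn.tendsto_of_hasDerivAt`), and the
inverse function theorem then gives its derivative. The critical damping turns out to be m / (I η).
-/

/-! ### Existence of solutions for continuous vector fields -/

section Peano

variable {E : Type*} [NormedAddCommGroup E] [NormedSpace ℝ E]

/-- Telescoping sum of one-step errors. With v = 0 it yields the Lipschitz bound on Euler polygons;
with v = f (γ τ) it yields the derivative of their limit. -/
lemma norm_eulerStep_sub_le {f : E → E} {δ η : ℝ} (hδ : 0 ≤ δ) {y : ℕ → E}
    (hy : ∀ k, y (k + 1) = y k + δ • f (y k)) (v : E) {i j : ℕ} (hij : i ≤ j)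
    (h : ∀ k, i ≤ k → k < j → ‖f (y k) - v‖ ≤ η) :
    ‖y j - y i - (((j : ℝ) - i) * δ) • v‖ ≤ η * (((j : ℝ) - i) * δ) := by
  induction j, hij using Nat.le_induction with
  | base => simp
  | succ j hij ih =>
    have h1 := ih fun k hk hkj => h k hk (by omega)
    have h2 := h j hij (by omega)
    have e : y (j + 1) - y i - ((((j + 1 : ℕ) : ℝ) - i) * δ) • v
        = (y j - y i - (((j : ℝ) - i) * δ) • v) + δ • (f (y j) - v) := by
      rw [hy]; push_cast; module
    rw [e]
    refine (norm_add_le _ _).trans ?_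
    rw [norm_smul, Real.norm_of_nonneg hδ]
    push_cast
    nlinarith [mul_le_mul_of_nonneg_left h2 hδ]

lemma norm_eulerStep_sub_le_of_bounded {f : E → E} {δ C : ℝ} (hδ : 0 ≤ δ) {y : ℕ → E}
    (hy : ∀ k, y (k + 1) = y k + δ • f (y k)) (hC : ∀ x, ‖f x‖ ≤ C) {a b i j : ℕ}
    (ha : a ∈ Icc i j) (hb : b ∈ Icc i j) :
    ‖y a - y b‖ ≤ C * (((j : ℝ) - i) * δ) := by
  have hC0 : 0 ≤ C := (norm_nonneg _).trans (hC 0)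
  wlog hab : b ≤ a generalizing a b
  · rw [norm_sub_rev]
    exact this hb ha (by omega)
  have h := norm_eulerStep_sub_le (η := C) hδ hy 0 hab fun k _ _ => by simpa using hC _
  rw [smul_zero, sub_zero] at h
  refine h.trans ?_
  have h1 : (a : ℝ) ≤ j := by exact_mod_cast ha.2
  have h2 : (i : ℝ) ≤ b := by exact_mod_cast hb.1
  gcongr

/-- **Peano existence theorem** for a bounded continuous vector field. -/
theorem exists_isIntegralCurveOn_Ici_of_bounded [FiniteDimensional ℝ E] {f : E → E}
    (hf : Continuous f) {C : ℝ} (hC : ∀ x, ‖f x‖ ≤ C) (x₀ : E) :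
    ∃ γ : ℝ → E, γ 0 = x₀ ∧ IsIntegralCurveOn γ (fun _ => f) (Ici 0) := by
  have : ProperSpace E := FiniteDimensional.proper ℝ E
  have hC0 : 0 ≤ C := (norm_nonneg _).trans (hC 0)
  let δ : ℕ → ℝ := fun n => (n : ℝ)⁻¹
  have hδ : ∀ n, 0 ≤ δ n := fun n => by positivity
  let y : ℕ → ℕ → E := fun n k => (fun x => x + δ n • f x)^[k] x₀
  have hy : ∀ n k, y n (k + 1) = y n k + δ n • f (y n k) := fun n k => by
    simp only [y, Function.iterate_succ_apply']
  let N : ℕ → ℝ → ℕ := fun n t => ⌊t * n⌋₊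
  have hN0 : ∀ n, N n 0 = 0 := fun n => by simp [N]
  have hNmono : ∀ n, Monotone (N n) := fun n s t hst => by
    dsimp only [N]; gcongr
  have hNlim : ∀ t, 0 ≤ t → Tendsto (fun n => (N n t : ℝ) * δ n) atTop (𝓝 t) := fun t ht => by
    simpa [N, δ, div_eq_mul_inv, Function.comp_def] using
      (tendsto_nat_floor_mul_div_atTop ht).comp (tendsto_natCast_atTop_atTop (R := ℝ))
  -- Limits along a free ultrafilter exist for all times simultaneously, by compactness of closed
  -- balls. This replaces Arzelà–Ascoli and the extraction of subsequences. The degenerate index n =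
  -- 0, with step 0, does not matter.
  let U : Ultrafilter ℕ := hyperfilter ℕ
  have hU : (U : Filter ℕ) ≤ atTop := by
    rw [← Nat.cofinite_eq_atTop]; exact hyperfilter_le_cofinite
  have hdlim : ∀ s t, 0 ≤ s → 0 ≤ t →
      Tendsto (fun n => ((N n t : ℝ) - N n s) * δ n) U (𝓝 (t - s)) := fun s t hs ht => by
    simpa only [sub_mul] using ((hNlim t ht).sub (hNlim s hs)).mono_left hU
  have hlim : ∀ t, ∃ z, 0 ≤ t → Tendsto (fun n => y n (N n t)) U (𝓝 z) := fun t => by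
    by_cases ht : 0 ≤ t
    · have hev : ∀ᶠ n in (U : Filter ℕ), y n (N n t) ∈ Metric.closedBall x₀ (C * (t + 1)) := by
        have := (hdlim 0 t le_rfl ht).eventually (gt_mem_nhds (show t - 0 < t + 1 by linarith))
        filter_upwards [this] with n hn
        rw [mem_closedBall_iff_norm]
        have h := norm_eulerStep_sub_le_of_bounded (hδ n) (hy n) hC
          (a := N n t) (b := N n 0) (i := N n 0) (j := N n t)
          ⟨hNmono n ht, le_rfl⟩ ⟨le_rfl, hNmono n ht⟩
        have e : y n (N n 0) = x₀ := by rw [hN0]; rfl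
        rw [e] at h
        exact h.trans (by gcongr)
      obtain ⟨z, -, hz⟩ := (isCompact_closedBall x₀ (C * (t + 1))).ultrafilter_le_nhds
        (U.map fun n => y n (N n t)) (le_principal_iff.2 hev)
      exact ⟨z, fun _ => hz⟩
    · exact ⟨0, fun h => absurd h ht⟩
  choose γ hγ using hlim
  -- For large n every Euler point between times s and t lies within ρ of γ τ, so the telescoping
  -- estimate with v = f (γ τ) passes to the limit. Taking τ as either end point gives the one-sided
  -- difference quotients.
  have key : ∀ s t τ, 0 ≤ s → τ ∈ Icc s t → ∀ ρ η, C * (t - s) < ρ →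
      (∀ z, ‖z - γ τ‖ < ρ → ‖f z - f (γ τ)‖ ≤ η) →
      ‖γ t - γ s - (t - s) • f (γ τ)‖ ≤ η * (t - s) := by
    intro s t τ hs hτ ρ η hρ hz
    have hτ0 : 0 ≤ τ := hs.trans hτ.1
    have ht : 0 ≤ t := hτ0.trans hτ.2
    have hd := hdlim s t hs ht
    have h1 : Tendsto (fun n => C * (((N n t : ℝ) - N n s) * δ n) + ‖y n (N n τ) - γ τ‖) U
        (𝓝 (C * (t - s) + ‖γ τ - γ τ‖)) :=
      (hd.const_mul C).add ((hγ τ hτ0).sub_const _).norm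
    rw [sub_self, norm_zero, add_zero] at h1
    refine le_of_tendsto_of_tendsto
      (((hγ t ht).sub (hγ s hs)).sub (hd.smul_const (f (γ τ)))).norm (hd.const_mul η) ?_
    filter_upwards [h1.eventually (gt_mem_nhds hρ)] with n hn
    refine norm_eulerStep_sub_le (hδ n) (hy n) _ (hNmono n (hτ.1.trans hτ.2)) fun k hk1 hk2 =>
      hz _ ?_
    have h2 := norm_eulerStep_sub_le_of_bounded (hδ n) (hy n) hC (a := k) (b := N n τ)
      (i := N n s) (j := N n t) ⟨hk1, hk2.le⟩ ⟨hNmono n hτ.1, hNmono n hτ.2⟩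
    calc ‖y n k - γ τ‖ ≤ ‖y n k - y n (N n τ)‖ + ‖y n (N n τ) - γ τ‖ := norm_sub_le_norm_sub_add_norm_sub ..
      _ < ρ := by linarith
  refine ⟨γ, ?_, fun τ hτ => ?_⟩
  · refine tendsto_nhds_unique (hγ 0 le_rfl) ?_
    have e : ∀ n, y n (N n 0) = x₀ := fun n => by rw [hN0]; rfl
    simp only [e]
    exact tendsto_const_nhds
  · rw [hasDerivWithinAt_iff_isLittleO, Asymptotics.isLittleO_iff]
    intro c hc
    obtain ⟨ρ, hρ, hz⟩ := Metric.continuousAt_iff.1 (hf.continuousAt (x := γ τ)) c hc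
    have hz' : ∀ z, ‖z - γ τ‖ < ρ → ‖f z - f (γ τ)‖ ≤ c := fun z h => by
      simpa only [dist_eq_norm] using (hz (by rwa [dist_eq_norm])).le
    have hev : ∀ᶠ t in 𝓝[Ici 0] τ, C * |t - τ| < ρ := by
      have : Tendsto (fun t => C * |t - τ|) (𝓝[Ici 0] τ) (𝓝 (C * |τ - τ|)) := by
        apply Tendsto.mono_left _ nhdsWithin_le_nhds
        exact Continuous.tendsto (by fun_prop) _
      refine this.eventually (gt_mem_nhds ?_)
      simpa using hρ
    filter_upwards [hev, self_mem_nhdsWithin] with t ht ht0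
    rcases le_total τ t with h | h
    · rw [abs_of_nonneg (sub_nonneg.2 h)] at ht
      rw [Real.norm_of_nonneg (sub_nonneg.2 h)]
      exact key τ t τ hτ ⟨le_rfl, h⟩ ρ c ht hz'
    · rw [abs_of_nonpos (sub_nonpos.2 h), neg_sub] at ht
      rw [Real.norm_of_nonpos (sub_nonpos.2 h), neg_sub]
      have := key t τ τ ht0 ⟨h, le_rfl⟩ ρ c ht hz'
      rwa [← norm_neg, show -(γ t - γ τ - (t - τ) • f (γ τ))
        = γ τ - γ t - (τ - t) • f (γ τ) by module]

/-- The retraction of a normed space onto the closed ball of radius `r` around `p`. -/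
noncomputable def radialClip (p : E) (r : ℝ) (x : E) : E :=
  p + (r / max r ‖x - p‖) • (x - p)

lemma continuous_radialClip (p : E) {r : ℝ} (hr : 0 < r) : Continuous (radialClip p r) := by
  unfold radialClip
  have : ∀ x, max r ‖x - p‖ ≠ 0 := fun x => (hr.trans_le (le_max_left _ _)).ne'
  fun_prop (disch := assumption)

lemma radialClip_mem (p : E) {r : ℝ} (hr : 0 < r) (x : E) :
    radialClip p r x ∈ Metric.closedBall p r := by
  have h0 : 0 < max r ‖x - p‖ := hr.trans_le (le_max_left _ _)
  rw [mem_closedBall_iff_norm, radialClip, add_sub_cancel_left, norm_smul,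
    Real.norm_of_nonneg (by positivity), div_mul_eq_mul_div, div_le_iff₀ h0]
  gcongr
  exact le_max_right _ _

lemma radialClip_of_mem {p : E} {r : ℝ} (hr : 0 < r) {x : E} (hx : x ∈ Metric.closedBall p r) :
    radialClip p r x = x := by
  rw [mem_closedBall_iff_norm] at hx
  rw [radialClip, max_eq_left hx, div_self hr.ne', one_smul, add_sub_cancel]

/-- A vector field continuous on a closed ball agrees there with a vector field all of whose
initial value problems have solutions for all positive times. -/
theorem exists_eqOn_closedBall_forall_isIntegralCurveOn [FiniteDimensional ℝ E] {f : E → E}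
    {p : E} {r : ℝ} (hr : 0 < r) (hf : ContinuousOn f (Metric.closedBall p r)) :
    ∃ g : E → E, EqOn g f (Metric.closedBall p r) ∧
      ∀ x₀, ∃ γ : ℝ → E, γ 0 = x₀ ∧ IsIntegralCurveOn γ (fun _ => g) (Ici 0) := by
  have : ProperSpace E := FiniteDimensional.proper ℝ E
  obtain ⟨C, hC⟩ := (isCompact_closedBall p r).exists_bound_of_continuousOn hf
  refine ⟨f ∘ radialClip p r, fun x hx => ?_, fun x₀ => ?_⟩
  · rw [Function.comp_apply, radialClip_of_mem hr hx]
  · exact exists_isIntegralCurveOn_Ici_of_bounded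
      (hf.comp_continuous (continuous_radialClip p hr) (radialClip_mem p hr))
      (fun x => hC _ (radialClip_mem p hr x)) x₀

end Peano

/-! ### Lyapunov and Chetaev theorems for quadratic functions -/

section QuadraticLyapunov

/-- Grönwall's inequality, since w(t) exp(-κ t) is nonincreasing. Neither w nor κ has a prescribed
sign, so it covers decay and growth alike. -/
lemma le_mul_exp_of_hasDerivWithinAt_le {w w' : ℝ → ℝ} {κ T : ℝ}
    (hw : ∀ t ∈ Icc 0 T, HasDerivWithinAt w (w' t) (Icc 0 T) t)
    (h : ∀ t ∈ Icc 0 T, w' t ≤ κ * w t) {t : ℝ} (ht : t ∈ Icc 0 T) :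
    w t ≤ w 0 * Real.exp (κ * t) := by
  have hd : ∀ s ∈ Icc 0 T, HasDerivWithinAt (fun s => w s * Real.exp (-κ * s))
      (w' s * Real.exp (-κ * s) + w s * (Real.exp (-κ * s) * (-κ * 1))) (Icc 0 T) s := fun s hs =>
    (hw s hs).mul (((hasDerivAt_id' s).const_mul (-κ)).exp.hasDerivWithinAt)
  have hanti : AntitoneOn (fun s => w s * Real.exp (-κ * s)) (Icc 0 T) := by
    refine antitoneOn_of_hasDerivWithinAt_nonpos (convex_Icc 0 T)
      (fun s hs => (hd s hs).continuousWithinAt)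
      (fun s hs => (hd s (interior_subset hs)).mono interior_subset) fun s hs => ?_
    have := h s (interior_subset hs)
    nlinarith [Real.exp_pos (-κ * s)]
  have h1 := hanti ⟨le_rfl, ht.1.trans ht.2⟩ ht ht.1
  simp only [mul_zero, Real.exp_zero, mul_one] at h1
  calc w t = w t * Real.exp (-κ * t) * Real.exp (κ * t) := by
        rw [mul_assoc, ← Real.exp_add]; simp
    _ ≤ w 0 * Real.exp (κ * t) := by gcongr

lemma exists_first_exit {X : Type*} [PseudoMetricSpace X] {γ : ℝ → X} {p : X} {T ρ : ℝ}
    (hγ : ContinuousOn γ (Icc 0 T)) (h0 : dist (γ 0) p < ρ)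
    (h : ∃ t ∈ Icc 0 T, ρ ≤ dist (γ t) p) :
    ∃ t₀ ∈ Icc 0 T, dist (γ t₀) p = ρ ∧ ∀ t ∈ Icc 0 t₀, dist (γ t) p ≤ ρ := by
  have hu : ContinuousOn (fun t => dist (γ t) p) (Icc 0 T) := 
    (continuous_id.dist continuous_const).comp_continuousOn hγ
  have hcomp : IsCompact (Icc 0 T ∩ (fun t => dist (γ t) p) ⁻¹' Ici ρ) :=
    isCompact_Icc.of_isClosed_subset (hu.preimage_isClosed_of_isClosed isClosed_Icc isClosed_Ici)
      inter_subset_left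
  obtain ⟨t₁, ht₁, h₁⟩ := h
  obtain ⟨t₀, ⟨ht₀, hρ⟩, hleast⟩ := hcomp.exists_isLeast ⟨t₁, ht₁, h₁⟩
  have hlt : ∀ t ∈ Icc 0 T, t < t₀ → dist (γ t) p < ρ := fun t ht htt => by
    by_contra! hcon
    exact htt.not_ge (hleast ⟨ht, hcon⟩)
  have heq : dist (γ t₀) p = ρ := by
    obtain ⟨t, ht, hte⟩ := intermediate_value_Icc ht₀.1 (hu.mono (Icc_subset_Icc_right ht₀.2))
      ⟨h0.le, hρ⟩
    have : t₀ ≤ t := hleast ⟨⟨ht.1, ht.2.trans ht₀.2⟩, hte.ge⟩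
    rwa [le_antisymm ht.2 this] at hte
  refine ⟨t₀, ht₀, heq, fun t ht => ?_⟩
  rcases ht.2.eq_or_lt with rfl | hlt'
  · exact heq.le
  · exact (hlt t ⟨ht.1, ht.2.trans ht₀.2⟩ hlt').le

variable {E : Type*} [NormedAddCommGroup E] [NormedSpace ℝ E]

/-- The constant is the minimum over the compact unit sphere, extended by homogeneity; the sphere is
empty only in the trivial space. -/
lemma exists_pos_mul_norm_sq_le [FiniteDimensional ℝ E] {N : E → ℝ} (hN : Continuous N)
    (hom : ∀ (c : ℝ) u, N (c • u) = c ^ 2 * N u) (hpos : ∀ u, u ≠ 0 → 0 < N u) :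
    ∃ c > 0, ∀ u, c * ‖u‖ ^ 2 ≤ N u := by
  have : ProperSpace E := FiniteDimensional.proper ℝ E
  have h0 : N 0 = 0 := by simpa using hom 0 0
  rcases (Metric.sphere (0 : E) 1).eq_empty_or_nonempty with he | hne
  · refine ⟨1, one_pos, fun u => ?_⟩
    have hu : u = 0 := by
      by_contra hu
      have : ‖u‖⁻¹ • u ∈ Metric.sphere (0 : E) 1 := by
        simp [norm_smul, norm_ne_zero_iff.2 hu]
      simp [he] at this
    simp [hu, h0]
  · obtain ⟨v, hv, hmin⟩ := (isCompact_sphere (0 : E) 1).exists_isMinOn hne hN.continuousOn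
    have hv0 : v ≠ 0 := by
      rintro rfl
      simp at hv
    refine ⟨N v, hpos v hv0, fun u => ?_⟩
    by_cases hu : u = 0
    · simp [hu, h0]
    · have hmem : ‖u‖⁻¹ • u ∈ Metric.sphere (0 : E) 1 := by
        simp [norm_smul, norm_ne_zero_iff.2 hu]
      have h1 : N v ≤ N (‖u‖⁻¹ • u) := hmin hmem
      have hu' : 0 < ‖u‖ := norm_pos_iff.2 hu
      rw [hom, inv_pow, inv_mul_eq_div, le_div_iff₀ (by positivity)] at h1
      exact h1

lemma ContinuousLinearMap.exists_pos_apply_self_le (B : E →L[ℝ] E →L[ℝ] ℝ) :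
    ∃ C > 0, ∀ u, B u u ≤ C * ‖u‖ ^ 2 := by
  refine ⟨‖B‖ + 1, by positivity, fun u => ?_⟩
  have h1 := (le_abs_self _).trans (B.le_opNorm₂ u u)
  nlinarith [sq_nonneg ‖u‖]

/-- The strict estimate for the linear part survives the o(‖x - p‖) remainder: each of the two cross
terms costs at most a quarter of c. Both orders of the arguments occur because `B` need not be
symmetric. -/
lemma eventually_mul_norm_sq_le_of_hasFDerivAt {f : E → E} {A : E →L[ℝ] E} {p : E}
    (hf : HasFDerivAt f A p) (hp : f p = 0) (B : E →L[ℝ] E →L[ℝ] ℝ) {c : ℝ} (hc : 0 < c)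
    (hB : ∀ u, c * ‖u‖ ^ 2 ≤ B u (A u) + B (A u) u) :
    ∀ᶠ x in 𝓝 p, c / 2 * ‖x - p‖ ^ 2 ≤ B (x - p) (f x) + B (f x) (x - p) := by
  have hη : 0 < c / (4 * (‖B‖ + 1)) := by positivity
  filter_upwards [(Asymptotics.isLittleO_iff.1 hf.isLittleO) hη] with x hx
  rw [hp, sub_zero] at hx
  set u := x - p
  set R := f x - A u
  have hfx : f x = A u + R := by simp [R]
  have h1 : |B u R| ≤ c / 4 * ‖u‖ ^ 2 := by
    refine (B.le_opNorm₂ u R).trans ?_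
    calc ‖B‖ * ‖u‖ * ‖R‖ ≤ (‖B‖ + 1) * ‖u‖ * (c / (4 * (‖B‖ + 1)) * ‖u‖) := by
          gcongr; linarith
      _ = c / 4 * ‖u‖ ^ 2 := by field_simp
  have h2 : |B R u| ≤ c / 4 * ‖u‖ ^ 2 := by
    refine (B.le_opNorm₂ R u).trans ?_
    calc ‖B‖ * ‖R‖ * ‖u‖ ≤ (‖B‖ + 1) * (c / (4 * (‖B‖ + 1)) * ‖u‖) * ‖u‖ := by
          gcongr; linarith
      _ = c / 4 * ‖u‖ ^ 2 := by field_simp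
  have h3 := hB u
  rw [hfx]
  simp only [map_add, add_apply]
  linarith [neg_le_of_abs_le h1, neg_le_of_abs_le h2]

/-- Exponential lower bound for a quadratic function along an integral curve. -/
lemma IsIntegralCurveOn.mul_exp_le_bilin {g : E → E} {p : E} {γ : ℝ → E} {T κ : ℝ}
    (hγ : IsIntegralCurveOn γ (fun _ => g) (Icc 0 T)) (B : E →L[ℝ] E →L[ℝ] ℝ)
    (h : ∀ t ∈ Icc 0 T, κ * B (γ t - p) (γ t - p) ≤
      B (γ t - p) (g (γ t)) + B (g (γ t)) (γ t - p)) {t : ℝ} (ht : t ∈ Icc 0 T) :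
    B (γ 0 - p) (γ 0 - p) * Real.exp (κ * t) ≤ B (γ t - p) (γ t - p) := by
  have hd : ∀ t ∈ Icc 0 T, HasDerivWithinAt (fun t => -B (γ t - p) (γ t - p))
      (-(B (γ t - p) (g (γ t)) + B (g (γ t)) (γ t - p))) (Icc 0 T) t := fun t ht =>
    (B.hasDerivWithinAt_of_bilinear ((hγ t ht).sub_const p) ((hγ t ht).sub_const p)).neg
  have := le_mul_exp_of_hasDerivWithinAt_le (κ := κ) hd
    (fun t ht => by linarith [h t ht]) ht
  linarith

/-- A positive definite quadratic function decaying along the flow keeps solutions that start close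
to `p` close to `p`. -/
lemma IsIntegralCurveOn.dist_lt_of_lyapunov {g : E → E} {p : E} {B : E →L[ℝ] E →L[ℝ] ℝ}
    {c C κ r θ ε : ℝ} (hκ : 0 < κ) (hc : ∀ u, c * ‖u‖ ^ 2 ≤ B u u) (hC0 : 0 ≤ C)
    (hC : ∀ u, B u u ≤ C * ‖u‖ ^ 2) (hθ : θ ≤ 1) (hθC : C * θ ^ 2 < c)
    (hB : ∀ x ∈ Metric.closedBall p r, B (x - p) (g x) + B (g x) (x - p) ≤
      -κ * B (x - p) (x - p)) (hε : 0 < ε) (hεr : ε ≤ r) {γ : ℝ → E} {T : ℝ}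
    (hγ : IsIntegralCurveOn γ (fun _ => g) (Icc 0 T)) (h0 : dist (γ 0) p < θ * ε) {t : ℝ}
    (ht : t ∈ Icc 0 T) : dist (γ t) p < ε := by
  by_contra! hcon
  obtain ⟨t₀, ht₀, heq, hle⟩ := exists_first_exit
    (fun t ht => (hγ t ht).continuousWithinAt) (h0.trans_le (by nlinarith)) ⟨t, ht, hcon⟩
  -- The lower bound for -B with rate -κ is the upper bound B(t) ≤ B(0) exp(-κ t). At the first exit
  -- it would give c ε² ≤ C (θ ε)², against C θ² < c.
  have h1 := (hγ.mono (Icc_subset_Icc_right ht₀.2)).mul_exp_le_bilin (-B) (p := p) (κ := -κ)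
    (fun s hs => by
      have := hB (γ s) ((hle s hs).trans hεr)
      simp only [neg_apply]
      linarith) (right_mem_Icc.2 ht₀.1)
  simp only [neg_apply] at h1
  rw [dist_eq_norm] at heq h0
  have h2 := hc (γ t₀ - p)
  have h3 := hC (γ 0 - p)
  rw [heq] at h2
  have h4 : Real.exp (-κ * t₀) ≤ 1 := Real.exp_le_one_iff.2 (by nlinarith [ht₀.1])
  have h5 : ‖γ 0 - p‖ ^ 2 ≤ (θ * ε) ^ 2 := by gcongr
  have hc0 : 0 < c := lt_of_le_of_lt (by positivity) hθC
  have h6 : 0 ≤ B (γ 0 - p) (γ 0 - p) := le_trans (by positivity) (hc _)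
  have h7 : c * ε ^ 2 ≤ C * (θ * ε) ^ 2 := by nlinarith
  have : 0 < (c - C * θ ^ 2) * ε ^ 2 := mul_pos (by linarith) (by positivity)
  nlinarith

/-- **Lyapunov's theorem** for a quadratic Lyapunov function of the linearization. -/
theorem isAsymptoticallyStable_of_bilin [FiniteDimensional ℝ E] {f : E → E} {D : Set E} {p : E}
    {A : E →L[ℝ] E} (hD : D ∈ 𝓝 p) (hcont : ∀ᶠ x in 𝓝 p, ContinuousAt f x) (hp : f p = 0)
    (hf : HasFDerivAt f A p) (B : E →L[ℝ] E →L[ℝ] ℝ) (hBpos : ∀ u, u ≠ 0 → 0 < B u u)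
    (hBneg : ∀ u, u ≠ 0 → B u (A u) + B (A u) u < 0) :
    IsAsymptoticallyStable f D p := by
  obtain ⟨c, hc0, hc⟩ := exists_pos_mul_norm_sq_le (N := fun u => B u u) (by fun_prop)
    (fun a u => by simp [sq, mul_assoc]) hBpos
  obtain ⟨C, hC0, hC⟩ := B.exists_pos_apply_self_le
  obtain ⟨e, he0, he⟩ := exists_pos_mul_norm_sq_le (N := fun u => -(B u (A u) + B (A u) u))
    (by fun_prop) (fun a u => by simp; ring) (fun u hu => neg_pos.2 (hBneg u hu))
  have hev := eventually_mul_norm_sq_le_of_hasFDerivAt hf hp (-B) he0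
    (fun u => by simpa [add_comm] using he u)
  obtain ⟨r, hr0, hr⟩ := Metric.nhds_basis_closedBall.mem_iff.1 ((hev.and hcont).and hD)
  have hrD : Metric.closedBall p r ⊆ D := fun x hx => (hr hx).2
  -- Near p the derivative is at most -(e/2)‖x - p‖², and B ≤ C‖x - p‖² converts this into the rate
  -- κ.
  set κ := e / 2 / C
  have hκ : 0 < κ := by positivity
  have hB : ∀ x ∈ Metric.closedBall p r, B (x - p) (f x) + B (f x) (x - p) ≤
      -κ * B (x - p) (x - p) := fun x hx => by
    have h1 := (hr hx).1.1
    simp only [neg_apply] at h1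
    have h2 : κ * B (x - p) (x - p) ≤ e / 2 * ‖x - p‖ ^ 2 :=
      (mul_le_mul_of_nonneg_left (hC _) hκ.le).trans_eq (by simp only [κ]; field_simp)
    linarith
  obtain ⟨θ, hθ0, hθ1, hθC⟩ : ∃ θ : ℝ, 0 < θ ∧ θ ≤ 1 ∧ C * θ ^ 2 < c := by
    have h1 : c / (C + c) ≤ 1 := by rw [div_le_one (by positivity)]; linarith
    refine ⟨c / (C + c), by positivity, h1, ?_⟩
    have h2 : C * (c / (C + c)) < c := by
      rw [mul_div_assoc', div_lt_iff₀ (by positivity)]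
      nlinarith
    have h3 : 0 < c / (C + c) := by positivity
    nlinarith [mul_pos hC0 h3]
  refine ⟨⟨mem_of_mem_nhds hD, hp⟩, fun ε hε => ?_, θ * r, by positivity, fun x₀ hx₀ hdist =>
    ⟨?_, fun γ hγ h0 => ?_⟩⟩
  · refine ⟨θ * min ε r, by positivity, fun T _ γ hγ h0 t ht => ?_⟩
    exact (hγ.2.dist_lt_of_lyapunov hκ hc hC0.le hC hθ1 hθC hB (lt_min hε hr0)
      (min_le_right _ _) h0 ht).trans_le (min_le_left _ _)
  -- A global solution of the modified field never leaves the ball, by the same Lyapunov estimate,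
  -- so it solves the original equation.
  · obtain ⟨g, hgf, hg⟩ := exists_eqOn_closedBall_forall_isIntegralCurveOn hr0
      (fun x hx => (hr hx).1.2.continuousWithinAt)
    obtain ⟨γ, h0, hγ⟩ := hg x₀
    have hmem : ∀ t ∈ Ici (0 : ℝ), γ t ∈ Metric.closedBall p r := fun t ht =>
      ((hγ.mono Icc_subset_Ici_self).dist_lt_of_lyapunov hκ hc hC0.le hC hθ1 hθC
        (fun x hx => by rw [hgf hx]; exact hB x hx) hr0 le_rfl (by rwa [h0])
        (right_mem_Icc.2 ht)).le
    refine ⟨γ, ⟨fun t ht => hrD (hmem t ht), fun t ht => ?_⟩, h0⟩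
    simpa only [hgf (hmem t ht)] using hγ t ht
  · have hmem : ∀ t ∈ Ici (0 : ℝ), γ t ∈ Metric.closedBall p r := fun t ht =>
      ((hγ.2.mono Icc_subset_Ici_self).dist_lt_of_lyapunov hκ hc hC0.le hC hθ1 hθC
        hB hr0 le_rfl (by rwa [h0]) (right_mem_Icc.2 ht)).le
    have hdecay : ∀ t ∈ Ici (0 : ℝ), ‖γ t - p‖ ^ 2 ≤
        c⁻¹ * (B (γ 0 - p) (γ 0 - p) * Real.exp (-κ * t)) := fun t ht => by
      have h1 := (hγ.2.mono (Icc_subset_Ici_self : Icc 0 t ⊆ _)).mul_exp_le_bilin (-B) (p := p)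
        (κ := -κ) (fun s hs => by
          have := hB (γ s) (hmem s hs.1)
          simp only [neg_apply]
          linarith) (right_mem_Icc.2 ht)
      simp only [neg_apply] at h1
      rw [← div_eq_inv_mul, le_div_iff₀ hc0]
      linarith [hc (γ t - p)]
    have hexp : Tendsto (fun t => c⁻¹ * (B (γ 0 - p) (γ 0 - p) * Real.exp (-κ * t))) atTop
        (𝓝 (c⁻¹ * (B (γ 0 - p) (γ 0 - p) * 0))) := by
      refine ((Real.tendsto_exp_atBot.comp ?_).const_mul _).const_mul _
      exact tendsto_id.const_mul_atTop_of_neg (neg_lt_zero.2 hκ)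
    rw [mul_zero, mul_zero] at hexp
    have hsq : Tendsto (fun t => ‖γ t - p‖ ^ 2) atTop (𝓝 0) :=
      squeeze_zero' (Eventually.of_forall fun t => by positivity)
        ((eventually_ge_atTop 0).mono hdecay) hexp
    rw [tendsto_iff_norm_sub_tendsto_zero]
    simpa using hsq.sqrt

/-- **Chetaev's instability theorem** for a quadratic function that grows along the
linearization. -/
theorem isUnstable_of_bilin [FiniteDimensional ℝ E] {f : E → E} {D : Set E} {p : E}
    {A : E →L[ℝ] E} (hD : D ∈ 𝓝 p) (hcont : ∀ᶠ x in 𝓝 p, ContinuousAt f x) (hp : f p = 0)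
    (hf : HasFDerivAt f A p) (B : E →L[ℝ] E →L[ℝ] ℝ) {u₀ : E} (hu₀ : 0 < B u₀ u₀)
    (hBpos : ∀ u, u ≠ 0 → 0 < B u (A u) + B (A u) u) :
    IsUnstable f D p := by
  obtain ⟨C, hC0, hC⟩ := B.exists_pos_apply_self_le
  obtain ⟨e, he0, he⟩ := exists_pos_mul_norm_sq_le (N := fun u => B u (A u) + B (A u) u)
    (by fun_prop) (fun a u => by simp; ring) hBpos
  have hev := eventually_mul_norm_sq_le_of_hasFDerivAt hf hp B he0 he
  obtain ⟨r, hr0, hr⟩ := Metric.nhds_basis_closedBall.mem_iff.1 ((hev.and hcont).and hD)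
  set κ := e / 2 / C
  have hκ : 0 < κ := by positivity
  have hB : ∀ x ∈ Metric.closedBall p r,
      κ * B (x - p) (x - p) ≤ B (x - p) (f x) + B (f x) (x - p) := fun x hx =>
    ((mul_le_mul_of_nonneg_left (hC _) hκ.le).trans_eq (by simp only [κ]; field_simp)).trans
      (hr hx).1.1
  refine ⟨⟨mem_of_mem_nhds hD, hp⟩, fun hst => ?_⟩
  obtain ⟨δ, hδ, hstab⟩ := hst r hr0
  have hu₀0 : 0 < ‖u₀‖ := norm_pos_iff.2 (by rintro rfl; simp at hu₀)
  obtain ⟨a, ha0, ha⟩ : ∃ a : ℝ, 0 < a ∧ a * ‖u₀‖ < min δ r := by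
    refine ⟨min δ r / 2 / ‖u₀‖, by positivity, ?_⟩
    rw [div_mul_cancel₀ _ hu₀0.ne']
    exact half_lt_self (lt_min hδ hr0)
  obtain ⟨g, hgf, hg⟩ := exists_eqOn_closedBall_forall_isIntegralCurveOn hr0
    (fun x hx => (hr hx).1.2.continuousWithinAt)
  obtain ⟨γ, h0, hγ⟩ := hg (p + a • u₀)
  have hdist : dist (γ 0) p < min δ r := by
    simpa [h0, dist_eq_norm, norm_smul, abs_of_pos ha0] using ha
  have hsol : ∀ T, (∀ t ∈ Icc 0 T, dist (γ t) p ≤ r) → IsSolutionOn f D γ (Icc 0 T) :=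
    fun T hT => ⟨fun t ht => (hr (hT t ht)).2, fun t ht => by
      have := (hγ t ht.1).mono (Icc_subset_Ici_self : Icc 0 T ⊆ _)
      simpa only [hgf (hT t ht)] using this⟩
  -- Up to a first exit from the ball γ solves the original equation, so the assumed stability keeps
  -- it strictly inside. Exponential growth of B then contradicts its bound C r² on the ball.
  have hstay : ∀ t ∈ Ici (0 : ℝ), dist (γ t) p < r := by
    intro t ht
    by_contra! hcon
    obtain ⟨t₀, ht₀, heq, hle⟩ := exists_first_exit (T := t)
      (fun s hs => ((hγ s hs.1).mono Icc_subset_Ici_self).continuousWithinAt)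
      (hdist.trans_le (min_le_right _ _)) ⟨t, right_mem_Icc.2 ht, hcon⟩
    have ht₀pos : 0 < t₀ := by
      refine ht₀.1.lt_of_ne ?_
      rintro rfl
      exact (hdist.trans_le (min_le_right _ _)).ne heq
    exact (hstab t₀ ht₀pos γ (hsol t₀ hle) (hdist.trans_le (min_le_left _ _)) t₀
      (right_mem_Icc.2 ht₀.1)).ne heq
  have hw0 : 0 < B (γ 0 - p) (γ 0 - p) := by
    rw [h0]
    simp
    positivity
  have hgrow : Tendsto (fun t => B (γ 0 - p) (γ 0 - p) * Real.exp (κ * t)) atTop atTop :=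
    (Real.tendsto_exp_atTop.comp (tendsto_id.const_mul_atTop hκ)).const_mul_atTop hw0
  obtain ⟨t, ht, ht0⟩ := ((hgrow.eventually_gt_atTop (C * r ^ 2)).and
    (eventually_ge_atTop 0)).exists
  have h1 := (hsol t fun s hs => (hstay s hs.1).le).2.mul_exp_le_bilin B (p := p) (κ := κ)
    (fun s hs => hB _ (hstay s hs.1).le) (right_mem_Icc.2 ht0)
  have h2 := hC (γ t - p)
  have h3 : ‖γ t - p‖ ≤ r := by
    rw [← dist_eq_norm]
    exact (hstay t ht0).le
  have h4 : C * ‖γ t - p‖ ^ 2 ≤ C * r ^ 2 := by gcongr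
  linarith

end QuadraticLyapunov

/-! ### The quadratic form for the linearized governor -/

section CubicLyapunov

/-- A quadratic Lyapunov function (as a bilinear map) for the system
`x' = y`, `y' = -a x - b y + c z`, `z' = -d x`, where `ε` weights the correction term. -/
noncomputable def governorBilin (a b c d ε : ℝ) :
    (ℝ × ℝ × ℝ) →L[ℝ] (ℝ × ℝ × ℝ) →L[ℝ] ℝ :=
  (LinearMap.mk₂ ℝ (fun u v : ℝ × ℝ × ℝ =>
    (c * u.2.2 - a * u.1) * (c * v.2.2 - a * v.1) / 2 + a * u.2.1 * v.2.1 / 2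
      + c * d * u.1 * v.2.1 + b * (c * d) / 2 * u.1 * v.1
      + ε * ((u.1 - u.2.1) * (c * v.2.2 - a * v.1) + b * u.2.1 * v.2.1))
    (fun _ _ _ => by simp; ring) (fun _ _ _ => by simp; ring) (fun _ _ _ => by simp; ring)
    (fun _ _ _ => by simp; ring)).toContinuousBilinearMap

lemma governorBilin_apply (a b c d ε : ℝ) (u v : ℝ × ℝ × ℝ) :
    governorBilin a b c d ε u v =
      (c * u.2.2 - a * u.1) * (c * v.2.2 - a * v.1) / 2 + a * u.2.1 * v.2.1 / 2
      + c * d * u.1 * v.2.1 + b * (c * d) / 2 * u.1 * v.1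
      + ε * ((u.1 - u.2.1) * (c * v.2.2 - a * v.1) + b * u.2.1 * v.2.1) := rfl

/-- With q = c z - a x, the main part contributes only -(ab - cd) y². The correction supplies the
missing -ε (c d x² + q²); all its other terms contain a factor y and can be absorbed for small ε. -/
lemma governorBilin_lieDeriv (a b c d ε x y z : ℝ) :
    governorBilin a b c d ε (x, y, z) (y, -a * x - b * y + c * z, -d * x)
      + governorBilin a b c d ε (y, -a * x - b * y + c * z, -d * x) (x, y, z) =
    -(a * b - c * d) * y ^ 2 - ε * (c * d * x ^ 2 + (c * z - a * x) ^ 2)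
      + ε * (y * ((c * d - a) * x + (1 + 3 * b) * (c * z - a * x) + (a - 2 * b ^ 2) * y)) := by
  simp only [governorBilin_apply]
  ring

/-- For small `ε` the quadratic form `δ y² + ε (k x² + q² - y (α x + β q + μ y))` is positive
definite. -/
lemma eventually_quadratic_pos {δ k : ℝ} (hδ : 0 < δ) (hk : 0 < k) (α β μ : ℝ) :
    ∀ᶠ ε in 𝓝[>] (0 : ℝ), ∀ x y q : ℝ, ¬ (x = 0 ∧ y = 0 ∧ q = 0) →
      0 < δ * y ^ 2 + ε * (k * x ^ 2 + q ^ 2) - ε * (y * (α * x + β * q + μ * y)) := by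
  have hlim : Tendsto (fun ε : ℝ => ε * (α ^ 2 / (2 * k) + β ^ 2 / 2 + μ)) (𝓝[>] 0)
      (𝓝 (0 * (α ^ 2 / (2 * k) + β ^ 2 / 2 + μ))) :=
    Tendsto.mono_left (Continuous.tendsto (by fun_prop) _) nhdsWithin_le_nhds
  rw [zero_mul] at hlim
  filter_upwards [hlim.eventually (gt_mem_nhds hδ), self_mem_nhdsWithin] with ε h1 hε x y q hne
  replace hε : 0 < ε := hε
  -- Completing squares spends half of k x² and half of q² on the mixed terms, at a cost of order ε
  -- in the coefficient of y².
  have e : δ * y ^ 2 + ε * (k * x ^ 2 + q ^ 2) - ε * (y * (α * x + β * q + μ * y))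
      = (δ - ε * (α ^ 2 / (2 * k) + β ^ 2 / 2 + μ)) * y ^ 2
        + ε * (k / 2 * x ^ 2 + q ^ 2 / 2 + k / 2 * (x - α / k * y) ^ 2
          + (q - β * y) ^ 2 / 2) := by
    field_simp
    ring
  rw [e]
  have h2 : 0 < δ - ε * (α ^ 2 / (2 * k) + β ^ 2 / 2 + μ) := by linarith
  by_cases hy : y = 0
  · subst hy
    by_cases hx : x = 0
    · have hq : q ≠ 0 := fun hq => hne ⟨hx, rfl, hq⟩
      positivity
    · positivity
  · positivity

/-- Quadratic Lyapunov function below the Hurwitz threshold. -/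
lemma exists_bilin_of_hurwitz {a b c d : ℝ} (ha : 0 < a) (hc : 0 < c) (hd : 0 < d)
    (h : c * d < a * b) :
    ∃ B : (ℝ × ℝ × ℝ) →L[ℝ] (ℝ × ℝ × ℝ) →L[ℝ] ℝ, (∀ u, u ≠ 0 → 0 < B u u) ∧
      ∀ u, u ≠ 0 → B u (u.2.1, -a * u.1 - b * u.2.1 + c * u.2.2, -d * u.1)
        + B (u.2.1, -a * u.1 - b * u.2.1 + c * u.2.2, -d * u.1) u < 0 := by
  have hk : 0 < c * d := by positivity
  have hne : ∀ x y z : ℝ, (x, y, z) ≠ (0 : ℝ × ℝ × ℝ) →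
      ¬ (x = 0 ∧ y = 0 ∧ c * z - a * x = 0) := by
    rintro x y z hu ⟨rfl, rfl, hq⟩
    have : z = 0 := by simpa [hc.ne'] using hq
    exact hu (by simp [this])
  have hpos : ∀ u : ℝ × ℝ × ℝ, u ≠ 0 → 0 < governorBilin a b c d 0 u u := by
    rintro ⟨x, y, z⟩ hu
    have h0 := hne x y z hu
    have e : governorBilin a b c d 0 (x, y, z) (x, y, z) = (c * z - a * x) ^ 2 / 2
        + a / 2 * (y + c * d / a * x) ^ 2 + c * d * (a * b - c * d) / (2 * a) * x ^ 2 := by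
      rw [governorBilin_apply]
      field_simp
      ring
    rw [e]
    have h1 : 0 < a * b - c * d := by linarith
    by_cases hx : x = 0
    · subst hx
      by_cases hy : y = 0
      · have hq : c * z - a * 0 ≠ 0 := fun hq => h0 ⟨rfl, hy, hq⟩
        positivity
      · rw [mul_zero (c * d / a), add_zero]
        positivity
    · positivity
  obtain ⟨e, he0, he⟩ := exists_pos_mul_norm_sq_le
    (N := fun u => governorBilin a b c d 0 u u) (by fun_prop)
    (fun t u => by simp [sq, mul_assoc]) hpos
  obtain ⟨C, hC0, hC⟩ :=
    (governorBilin a b c d 0 - governorBilin a b c d 1).exists_pos_apply_self_le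
  have hlim : Tendsto (fun ε : ℝ => ε * C) (𝓝[>] 0) (𝓝 (0 * C)) :=
    Tendsto.mono_left (Continuous.tendsto (by fun_prop) _) nhdsWithin_le_nhds
  rw [zero_mul] at hlim
  obtain ⟨ε, ⟨hε, hεC⟩, hε0⟩ := (((eventually_quadratic_pos (sub_pos.2 h) hk (c * d - a)
    (1 + 3 * b) (a - 2 * b ^ 2)).and (hlim.eventually (gt_mem_nhds he0))).and
    self_mem_nhdsWithin).exists
  replace hε0 : 0 < ε := hε0
  refine ⟨governorBilin a b c d ε, fun u hu => ?_, ?_⟩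
  -- The form is affine in ε, so its positive definiteness at ε = 0 persists once ε C < e.
  · have h1 : governorBilin a b c d ε u u = governorBilin a b c d 0 u u
        - ε * (governorBilin a b c d 0 - governorBilin a b c d 1) u u := by
      simp only [sub_apply, governorBilin_apply]
      ring
    have h2 := mul_le_mul_of_nonneg_left (hC u) hε0.le
    have h3 := he u
    have h4 : 0 < ‖u‖ := norm_pos_iff.2 hu
    have h5 : 0 < (e - ε * C) * ‖u‖ ^ 2 := mul_pos (by linarith) (by positivity)
    rw [h1]
    linarith
  · rintro ⟨x, y, z⟩ hu
    have := hε x y (c * z - a * x) (hne x y z hu)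
    rw [governorBilin_lieDeriv]
    linarith

/-- Quadratic Chetaev function above the Hurwitz threshold. -/
lemma exists_bilin_of_not_hurwitz {a b c d : ℝ} (hc : 0 < c) (hd : 0 < d)
    (h : a * b < c * d) :
    ∃ B : (ℝ × ℝ × ℝ) →L[ℝ] (ℝ × ℝ × ℝ) →L[ℝ] ℝ, (∃ u, 0 < B u u) ∧
      ∀ u, u ≠ 0 → 0 < B u (u.2.1, -a * u.1 - b * u.2.1 + c * u.2.2, -d * u.1)
        + B (u.2.1, -a * u.1 - b * u.2.1 + c * u.2.2, -d * u.1) u := by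
  have hk : 0 < c * d := by positivity
  have hne : ∀ x y z : ℝ, (x, y, z) ≠ (0 : ℝ × ℝ × ℝ) →
      ¬ (x = 0 ∧ y = 0 ∧ c * z - a * x = 0) := by
    rintro x y z hu ⟨rfl, rfl, hq⟩
    have : z = 0 := by simpa [hc.ne'] using hq
    exact hu (by simp [this])
  obtain ⟨ε, hε⟩ := (eventually_quadratic_pos (sub_pos.2 h) hk (c * d - a) (1 + 3 * b)
    (a - 2 * b ^ 2)).exists
  -- Beyond the threshold the y² term is already positive, so the correction must change sign. It
  -- vanishes at (0, 0, 1), where the form equals c²/2 for every ε.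
  refine ⟨governorBilin a b c d (-ε), ⟨(0, 0, 1), ?_⟩, ?_⟩
  · simp only [governorBilin_apply]
    norm_num
    positivity
  · rintro ⟨x, y, z⟩ hu
    have := hε x y (c * z - a * x) (hne x y z hu)
    rw [governorBilin_lieDeriv]
    linarith

end CubicLyapunov

/-! ### Continuity and differentiability of implicit branches -/

section MonotoneInverse

/-- A preimage under a monotone function depends continuously on the value at a point where the
derivative is positive. -/
lemma MonotoneOn.tendsto_of_hasDerivAt {α : Type*} {l : Filter α} {f : ℝ → ℝ} {S : Set ℝ}
    {x₀ f' : ℝ} (hf : MonotoneOn f S) (hS : S ∈ 𝓝 x₀) (hd : HasDerivAt f f' x₀) (hf' : 0 < f')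
    {u : α → ℝ} (hu : ∀ᶠ a in l, u a ∈ S) (hfu : Tendsto (fun a => f (u a)) l (𝓝 (f x₀))) :
    Tendsto u l (𝓝 x₀) := by
  have hslope : ∀ᶠ x in 𝓝[≠] x₀, 0 < slope f x₀ x ∧ x ∈ S :=
    (hd.tendsto_slope.eventually (lt_mem_nhds hf')).and (nhdsWithin_le_nhds hS)
  rw [tendsto_order]
  constructor
  · intro b hb
    have hleft : ∀ᶠ x in 𝓝[<] x₀, 0 < slope f x₀ x ∧ x ∈ S :=
      hslope.filter_mono (nhdsWithin_mono _ fun x (hx : x < x₀) => hx.ne)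
    obtain ⟨x, ⟨hx, hxS⟩, hxb⟩ := (hleft.and (Ioo_mem_nhdsLT hb)).exists
    rw [slope_comm, slope_pos_iff_of_le hxb.2.le] at hx
    filter_upwards [hu, hfu.eventually (lt_mem_nhds hx)] with a ha hfa
    by_contra! hcon
    exact hfa.not_ge (hf ha hxS (hcon.trans hxb.1.le))
  · intro b hb
    have hright : ∀ᶠ x in 𝓝[>] x₀, 0 < slope f x₀ x ∧ x ∈ S :=
      hslope.filter_mono (nhdsWithin_mono _ fun x (hx : x₀ < x) => hx.ne')
    obtain ⟨x, ⟨hx, hxS⟩, hxb⟩ := (hright.and (Ioo_mem_nhdsGT hb)).exists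
    rw [slope_pos_iff_of_le hxb.1.le] at hx
    filter_upwards [hu, hfu.eventually (gt_mem_nhds hx)] with a ha hfa
    by_contra! hcon
    exact hfa.not_ge (hf hxS ha (hxb.2.le.trans hcon))

/-- Since u tends to x₀, it eventually lies where the local inverse of f undoes f, so u agrees with
that inverse composed with v. -/
lemma HasStrictDerivAt.hasDerivAt_of_comp_eq {f u v : ℝ → ℝ} {f' v' x₀ t₀ : ℝ}
    (hf : HasStrictDerivAt f f' x₀) (hf' : f' ≠ 0) (hu : Tendsto u (𝓝 t₀) (𝓝 x₀))
    (hv : HasDerivAt v v' t₀) (huv : ∀ᶠ t in 𝓝 t₀, f (u t) = v t) :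
    HasDerivAt u (v' / f') t₀ := by
  have hF := hf.hasStrictFDerivAt_equiv hf'
  have hv₀ : v t₀ = f x₀ := by rw [← huv.self_of_nhds, eq_of_tendsto_nhds hu]
  have hinv : HasDerivAt (hf.localInverse f f' x₀ hf') f'⁻¹ (v t₀) :=
    hv₀ ▸ (hf.to_localInverse hf').hasDerivAt
  rw [div_eq_inv_mul]
  refine (hinv.comp t₀ hv).congr_of_eventuallyEq ?_
  filter_upwards [hu.eventually hF.eventually_left_inverse, huv] with t h1 h2
  rw [Function.comp_apply, ← h2]
  exact h1.symm

lemma HasStrictDerivAt.exists_comp_eq {f v : ℝ → ℝ} {f' x₀ t₀ : ℝ}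
    (hf : HasStrictDerivAt f f' x₀) (hf' : f' ≠ 0) (hv : ContinuousAt v t₀) (h : v t₀ = f x₀) :
    ∃ u : ℝ → ℝ, u t₀ = x₀ ∧ Tendsto u (𝓝 t₀) (𝓝 x₀) ∧ ∀ᶠ t in 𝓝 t₀, f (u t) = v t := by
  have hF := hf.hasStrictFDerivAt_equiv hf'
  have hv' : Tendsto v (𝓝 t₀) (𝓝 (f x₀)) := h ▸ hv
  refine ⟨fun t => hf.localInverse f f' x₀ hf' (v t), ?_, ?_, ?_⟩
  · simp only [h]
    exact hF.localInverse_apply_image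
  · exact (hF.localInverse_tendsto).comp hv'
  · exact hv'.eventually hF.eventually_right_inverse

end MonotoneInverse

/-! ### Equilibria, linearization and load dependence of the governor -/

namespace WattGovernor

variable (G : WattGovernor)

lemma isEquilibrium_iff {F φ Ω : ℝ} :
    IsEquilibrium (G.field F) stateSpace (φ, 0, Ω) ↔
      φ ∈ Ioo 0 (Real.pi / 2) ∧ 0 ≤ Ω ∧ G.s Ω ^ 2 * Real.cos φ = G.g / G.l ∧ G.M φ = F := by
  unfold IsEquilibrium stateSpace field
  simp only [mem_ofPred_eq, G.h_zero, Prod.mk_eq_zero, true_and, mul_zero, sub_zero, and_assoc]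
  refine and_congr_right fun hφ => and_congr_right fun _ => and_congr ?_ ?_
  · have hsin : Real.sin φ ≠ 0 :=
      (Real.sin_pos_of_pos_of_lt_pi hφ.1 (by linarith [hφ.2, Real.pi_pos])).ne'
    rw [show G.s Ω ^ 2 * Real.sin φ * Real.cos φ - G.g / G.l * Real.sin φ
      = (G.s Ω ^ 2 * Real.cos φ - G.g / G.l) * Real.sin φ by ring]
    simp [hsin, sub_eq_zero]
  · simp [G.I_pos.ne', sub_eq_zero]

lemma s_nonneg {Ω : ℝ} (hΩ : 0 ≤ Ω) : 0 ≤ G.s Ω := by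
  simpa [G.s_zero] using G.s_mono (mem_Ici.2 le_rfl) (mem_Ici.2 hΩ) hΩ

lemma s_pos_of_isEquilibrium {F φ Ω : ℝ}
    (h : IsEquilibrium (G.field F) stateSpace (φ, 0, Ω)) : 0 < G.s Ω := by
  obtain ⟨-, hΩ, h1, -⟩ := G.isEquilibrium_iff.1 h
  refine (G.s_nonneg hΩ).lt_of_ne' fun h0 => ?_
  have := div_pos G.g_pos G.l_pos
  rw [h0] at h1
  linarith

/-- At Ω = 0 nothing balances gravity, since s(0) = 0. Equilibria are therefore interior points of
the state space, where two-sided derivatives are available. -/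
lemma pos_of_isEquilibrium {F φ Ω : ℝ}
    (h : IsEquilibrium (G.field F) stateSpace (φ, 0, Ω)) : 0 < Ω := by
  refine (G.isEquilibrium_iff.1 h).2.1.lt_of_ne' ?_
  rintro rfl
  exact (G.s_pos_of_isEquilibrium h).ne' G.s_zero

lemma contDiffAt_s {Ω : ℝ} (hΩ : 0 < Ω) : ContDiffAt ℝ ∞ G.s Ω :=
  G.s_smooth.contDiffAt (Ici_mem_nhds hΩ)

lemma contDiffAt_M {φ : ℝ} (hφ : φ ∈ Ioo 0 (Real.pi / 2)) : ContDiffAt ℝ ∞ G.M φ :=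
  G.M_smooth.contDiffAt (Ioo_mem_nhds hφ.1 hφ.2)

lemma hasStrictDerivAt_s {Ω : ℝ} (hΩ : 0 < Ω) : HasStrictDerivAt G.s (deriv G.s Ω) Ω :=
  (G.contDiffAt_s hΩ).hasStrictDerivAt (by simp)

lemma hasStrictDerivAt_M {φ : ℝ} (hφ : φ ∈ Ioo 0 (Real.pi / 2)) :
    HasStrictDerivAt G.M (deriv G.M φ) φ :=
  (G.contDiffAt_M hφ).hasStrictDerivAt (by simp)

lemma eventually_mem_interior {φ Ω : ℝ} (hφ : φ ∈ Ioo 0 (Real.pi / 2)) (hΩ : 0 < Ω) (ψ : ℝ) :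
    ∀ᶠ x : ℝ × ℝ × ℝ in 𝓝 (φ, ψ, Ω), x.1 ∈ Ioo 0 (Real.pi / 2) ∧ 0 < x.2.2 :=
  (continuousAt_fst.eventually (Ioo_mem_nhds hφ.1 hφ.2)).and
    ((continuous_snd.comp continuous_snd).continuousAt.eventually (lt_mem_nhds hΩ))

lemma continuousAt_field (F : ℝ) {x : ℝ × ℝ × ℝ} (h1 : x.1 ∈ Ioo 0 (Real.pi / 2))
    (h2 : 0 < x.2.2) : ContinuousAt (G.field F) x := by
  have hs : ContinuousAt (fun y : ℝ × ℝ × ℝ => G.s y.2.2) x :=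
    ContinuousAt.comp' (G.contDiffAt_s h2).continuousAt (by fun_prop)
  have hM : ContinuousAt (fun y : ℝ × ℝ × ℝ => G.M y.1) x :=
    ContinuousAt.comp' (G.contDiffAt_M h1).continuousAt (by fun_prop)
  have hh : Continuous G.h := G.h_cont
  unfold field
  fun_prop

/-- The linearization of the governor system at an equilibrium. -/
lemma exists_hasFDerivAt_field {F φ Ω : ℝ}
    (hP : IsEquilibrium (G.field F) stateSpace (φ, 0, Ω)) :
    ∃ A : (ℝ × ℝ × ℝ) →L[ℝ] (ℝ × ℝ × ℝ), HasFDerivAt (G.field F) A (φ, 0, Ω) ∧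
      ∀ u, A u = (u.2.1, -(G.s Ω ^ 2 * Real.sin φ ^ 2) * u.1 - deriv G.h 0 / G.m * u.2.1
        + 2 * G.s Ω * deriv G.s Ω * Real.sin φ * Real.cos φ * u.2.2,
        -(-deriv G.M φ / G.I) * u.1) := by
  have hΩ := G.pos_of_isEquilibrium hP
  obtain ⟨hφ, -, heq, -⟩ := G.isEquilibrium_iff.1 hP
  set p : ℝ × ℝ × ℝ := (φ, 0, Ω) with hp
  have d1 : HasFDerivAt (fun x : ℝ × ℝ × ℝ => x.1) (ContinuousLinearMap.fst ℝ ℝ (ℝ × ℝ)) p :=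
    hasFDerivAt_fst
  have d2 : HasFDerivAt (fun x : ℝ × ℝ × ℝ => x.2.1)
      ((ContinuousLinearMap.fst ℝ ℝ ℝ).comp (ContinuousLinearMap.snd ℝ ℝ (ℝ × ℝ))) p :=
    hasFDerivAt_fst.comp p hasFDerivAt_snd
  have d3 : HasFDerivAt (fun x : ℝ × ℝ × ℝ => x.2.2)
      ((ContinuousLinearMap.snd ℝ ℝ ℝ).comp (ContinuousLinearMap.snd ℝ ℝ (ℝ × ℝ))) p :=
    hasFDerivAt_snd.comp p hasFDerivAt_snd
  have hs : HasDerivAt G.s (deriv G.s Ω) p.2.2 := (G.hasStrictDerivAt_s hΩ).hasDerivAt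
  have hM : HasDerivAt G.M (deriv G.M φ) p.1 := (G.hasStrictDerivAt_M hφ).hasDerivAt
  have hh : HasDerivAt G.h (deriv G.h 0) p.2.1 := G.h_diff.hasDerivAt
  have key := d2.prodMk ((((((hs.comp_hasFDerivAt p d3).pow 2).mul d1.sin).mul d1.cos).sub
    (d1.sin.const_mul (G.g / G.l))).sub ((hh.comp_hasFDerivAt p d2).const_mul (1 / G.m))
    |>.prodMk (((hM.comp_hasFDerivAt p d1).sub_const F).const_mul (1 / G.I)))
  refine ⟨_, key, fun u => ?_⟩
  -- Replacing g/l by s² cos φ reduces the φ-derivative s² cos 2φ - (g/l) cos φ to -s² sin² φ.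
  rw [← heq]
  ext
  · simp
  · simp [hp]
    ring
  · simp [hp]
    ring

/-- The Hurwitz determinant of the linearization compares the damping with its critical value. -/
lemma hurwitz_sub_eq {φ Ω : ℝ} (hφ : φ ∈ Ioo 0 (Real.pi / 2)) (hs : 0 < G.s Ω) :
    G.s Ω ^ 2 * Real.sin φ ^ 2 * (deriv G.h 0 / G.m) -
      2 * G.s Ω * deriv G.s Ω * Real.sin φ * Real.cos φ * (-deriv G.M φ / G.I) =
    G.s Ω ^ 2 * Real.sin φ ^ 2 / G.m * (deriv G.h 0 - G.criticalDamping φ Ω) := by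
  have hsin : Real.sin φ ≠ 0 :=
    (Real.sin_pos_of_pos_of_lt_pi hφ.1 (by linarith [hφ.2, Real.pi_pos])).ne'
  have := G.m_pos.ne'
  have := G.I_pos.ne'
  rw [criticalDamping, Real.cot_eq_cos_div_sin]
  field_simp

variable {G} {F φ₀ Ω₀ : ℝ}

lemma stability (hP : IsEquilibrium (G.field F) stateSpace (φ₀, 0, Ω₀))
    (hs : 0 < deriv G.s Ω₀) (hM : deriv G.M φ₀ < 0) :
    (G.criticalDamping φ₀ Ω₀ < deriv G.h 0 →
      IsAsymptoticallyStable (G.field F) stateSpace (φ₀, 0, Ω₀)) ∧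
    (deriv G.h 0 < G.criticalDamping φ₀ Ω₀ →
      IsUnstable (G.field F) stateSpace (φ₀, 0, Ω₀)) := by
  have hΩ := G.pos_of_isEquilibrium hP
  have hs0 := G.s_pos_of_isEquilibrium hP
  have hφ := (G.isEquilibrium_iff.1 hP).1
  have hsin : 0 < Real.sin φ₀ :=
    Real.sin_pos_of_pos_of_lt_pi hφ.1 (by linarith [hφ.2, Real.pi_pos])
  have hcos : 0 < Real.cos φ₀ :=
    Real.cos_pos_of_mem_Ioo ⟨by linarith [hφ.1, Real.pi_pos], hφ.2⟩
  have hm := G.m_pos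
  have hI := G.I_pos
  have hint := eventually_mem_interior hφ hΩ 0
  have hD : stateSpace ∈ 𝓝 (φ₀, (0 : ℝ), Ω₀) := hint.mono fun x hx => ⟨hx.1, hx.2.le⟩
  have hcont : ∀ᶠ x in 𝓝 (φ₀, (0 : ℝ), Ω₀), ContinuousAt (G.field F) x :=
    hint.mono fun x hx => G.continuousAt_field F hx.1 hx.2
  obtain ⟨A, hA, hAu⟩ := G.exists_hasFDerivAt_field hP
  have hurw := G.hurwitz_sub_eq hφ hs0
  have hfac : 0 < G.s Ω₀ ^ 2 * Real.sin φ₀ ^ 2 / G.m := by positivity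
  have ha : 0 < G.s Ω₀ ^ 2 * Real.sin φ₀ ^ 2 := by positivity
  have hc : 0 < 2 * G.s Ω₀ * deriv G.s Ω₀ * Real.sin φ₀ * Real.cos φ₀ := by positivity
  have hd : 0 < -deriv G.M φ₀ / G.I := div_pos (neg_pos.2 hM) hI
  constructor
  · intro h
    have := mul_pos hfac (sub_pos.2 h)
    obtain ⟨B, hB1, hB2⟩ := exists_bilin_of_hurwitz ha hc hd (b := deriv G.h 0 / G.m)
      (by linarith)
    exact isAsymptoticallyStable_of_bilin hD hcont hP.2 hA B hB1
      fun u hu => by rw [hAu]; exact hB2 u hu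
  · intro h
    have := mul_pos hfac (sub_pos.2 h)
    obtain ⟨B, ⟨u₀, hu₀⟩, hB2⟩ := exists_bilin_of_not_hurwitz
      (a := G.s Ω₀ ^ 2 * Real.sin φ₀ ^ 2) hc hd (b := deriv G.h 0 / G.m) (by linarith)
    exact isUnstable_of_bilin hD hcont hP.2 hA B hu₀
      fun u hu => by rw [hAu]; exact hB2 u hu

lemma exists_isEquilibriumBranch (hP : IsEquilibrium (G.field F) stateSpace (φ₀, 0, Ω₀))
    (hs : deriv G.s Ω₀ ≠ 0) (hM : deriv G.M φ₀ ≠ 0) :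
    ∃ Φ W : ℝ → ℝ, G.IsEquilibriumBranch F φ₀ Ω₀ Φ W := by
  have hΩ := G.pos_of_isEquilibrium hP
  have hs0 := G.s_pos_of_isEquilibrium hP
  obtain ⟨hφ, -, heq, hMF⟩ := G.isEquilibrium_iff.1 hP
  have hcos : Real.cos φ₀ ≠ 0 :=
    (Real.cos_pos_of_mem_Ioo ⟨by linarith [hφ.1, Real.pi_pos], hφ.2⟩).ne'
  obtain ⟨Φ, hΦ₀, hΦ, hMΦ⟩ := (G.hasStrictDerivAt_M hφ).exists_comp_eq hM
    (v := fun t => t) (t₀ := F) continuousAt_id hMF.symm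
  have hΦc : ContinuousAt Φ F := by rwa [ContinuousAt, hΦ₀]
  have hv : ContinuousAt (fun t => G.g / G.l / Real.cos (Φ t)) F :=
    continuousAt_const.div (Real.continuous_cos.continuousAt.comp' hΦc)
      (by rwa [hΦ₀])
  obtain ⟨W, hW₀, hW, hsW⟩ := ((G.hasStrictDerivAt_s hΩ).pow 2).exists_comp_eq
    (by simp [hs, hs0.ne']) hv (by
      simp only [Pi.pow_apply, hΦ₀]
      rw [← heq, mul_div_cancel_right₀ _ hcos])
  refine ⟨Φ, W, hΦ₀, hW₀, ?_⟩
  filter_upwards [hMΦ, hsW, hΦ.eventually (Ioo_mem_nhds hφ.1 hφ.2),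
    hW.eventually (lt_mem_nhds hΩ)] with t h1 h2 h3 h4
  have hcos' : Real.cos (Φ t) ≠ 0 :=
    (Real.cos_pos_of_mem_Ioo ⟨by linarith [h3.1, Real.pi_pos], h3.2⟩).ne'
  refine G.isEquilibrium_iff.2 ⟨h3, h4.le, ?_, h1⟩
  simp only [Pi.pow_apply] at h2
  rw [h2, div_mul_cancel₀ _ hcos']

lemma IsEquilibriumBranch.hasDerivAt {Φ W : ℝ → ℝ}
    (h : G.IsEquilibriumBranch F φ₀ Ω₀ Φ W) (hs : 0 < deriv G.s Ω₀) (hM : deriv G.M φ₀ < 0) :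
    HasDerivAt W (G.s Ω₀ / (2 * deriv G.M φ₀ * deriv G.s Ω₀) * Real.tan φ₀) F := by
  obtain ⟨hΦ₀, hW₀, hev⟩ := h
  have hP := hev.self_of_nhds
  rw [hΦ₀, hW₀] at hP
  have hΩ := G.pos_of_isEquilibrium hP
  have hs0 := G.s_pos_of_isEquilibrium hP
  obtain ⟨hφ, -, heq, hMF⟩ := G.isEquilibrium_iff.1 hP
  have hcos : Real.cos φ₀ ≠ 0 :=
    (Real.cos_pos_of_mem_Ioo ⟨by linarith [hφ.1, Real.pi_pos], hφ.2⟩).ne'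
  have hev' := hev.mono fun t ht => G.isEquilibrium_iff.1 ht
  have hΦ : Tendsto Φ (𝓝 F) (𝓝 φ₀) := by
    refine G.M_anti.neg.tendsto_of_hasDerivAt (Ioo_mem_nhds hφ.1 hφ.2)
      (G.hasStrictDerivAt_M hφ).hasDerivAt.neg (neg_pos.2 hM) (hev'.mono fun t ht => ht.1) ?_
    refine Tendsto.congr' (hev'.mono fun t ht => ?_)
      (show Tendsto (fun t : ℝ => -t) (𝓝 F) (𝓝 (-G.M φ₀)) from hMF ▸ tendsto_id.neg)
    simp [ht.2.2.2]
  have hΦ' : HasDerivAt Φ (1 / deriv G.M φ₀) F :=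
    (G.hasStrictDerivAt_M hφ).hasDerivAt_of_comp_eq hM.ne hΦ (hasDerivAt_id' F)
      (hev'.mono fun t ht => ht.2.2.2)
  have hv : HasDerivAt (fun t => G.g / G.l / Real.cos (Φ t))
      (G.g / G.l * Real.sin φ₀ * (1 / deriv G.M φ₀) / Real.cos φ₀ ^ 2) F := by
    have := (hasDerivAt_const F (G.g / G.l)).div hΦ'.cos (by rwa [hΦ₀])
    refine this.congr_deriv ?_
    rw [hΦ₀]
    ring
  have hsv : ∀ᶠ t in 𝓝 F, (G.s ^ 2) (W t) = G.g / G.l / Real.cos (Φ t) :=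
    hev'.mono fun t ⟨h1, _, h3, _⟩ => by
      have hcos' : Real.cos (Φ t) ≠ 0 :=
        (Real.cos_pos_of_mem_Ioo ⟨by linarith [h1.1, Real.pi_pos], h1.2⟩).ne'
      rw [Pi.pow_apply, ← h3, mul_div_cancel_right₀ _ hcos']
  have hs2 := (G.hasStrictDerivAt_s hΩ).pow 2
  have hW : Tendsto W (𝓝 F) (𝓝 Ω₀) := by
    -- Squaring preserves monotonicity because s is nonnegative on [0, ∞).
    have hmono : MonotoneOn (G.s ^ 2) (Ici 0) := fun x hx y hy hxy =>
      pow_le_pow_left₀ (G.s_nonneg hx) (G.s_mono hx hy hxy) 2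
    refine hmono.tendsto_of_hasDerivAt (Ici_mem_nhds hΩ) hs2.hasDerivAt
      (by simp; positivity) (hev'.mono fun t ht => ht.2.1) ?_
    refine (hv.continuousAt.tendsto.congr' (hsv.mono fun t ht => ht.symm)).trans_eq ?_
    rw [← hsv.self_of_nhds, hW₀]
  refine (hs2.hasDerivAt_of_comp_eq (by simp [hs.ne', hs0.ne']) hW hv hsv).congr_deriv ?_
  rw [← heq, Real.tan_eq_sin_div_cos]
  have := hM.ne
  field_simp
  simp
  ring

end WattGovernor

theorem theorem2p2 (G : WattGovernor) (F φ₀ Ω₀ : ℝ)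
    (hP : IsEquilibrium (G.field F) WattGovernor.stateSpace (φ₀, 0, Ω₀))
    (hs : 0 < deriv G.s Ω₀) (hM : deriv G.M φ₀ < 0) :
    (G.criticalDamping φ₀ Ω₀ < deriv G.h 0 →
      IsAsymptoticallyStable (G.field F) WattGovernor.stateSpace (φ₀, 0, Ω₀)) ∧
    (0 < deriv G.h 0 → deriv G.h 0 < G.criticalDamping φ₀ Ω₀ →
      IsUnstable (G.field F) WattGovernor.stateSpace (φ₀, 0, Ω₀)) ∧
    (∃ Φ W : ℝ → ℝ, G.IsEquilibriumBranch F φ₀ Ω₀ Φ W) ∧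
    (∀ Φ W : ℝ → ℝ, G.IsEquilibriumBranch F φ₀ Ω₀ Φ W →
      DifferentiableAt ℝ W F ∧
      |deriv W F| = -(G.s Ω₀ / (2 * deriv G.M φ₀ * deriv G.s Ω₀)) * Real.tan φ₀ ∧
      (G.criticalDamping φ₀ Ω₀ < deriv G.h 0 ↔ 1 < deriv G.h 0 * G.I / G.m * |deriv W F|)) := by
  obtain ⟨hstab, hinst⟩ := WattGovernor.stability hP hs hM
  refine ⟨hstab, fun _ => hinst, WattGovernor.exists_isEquilibriumBranch hP hs.ne' hM.ne,
    fun Φ W hb => ?_⟩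
  have hW := hb.hasDerivAt hs hM
  have hs0 := G.s_pos_of_isEquilibrium hP
  have hφ := (G.isEquilibrium_iff.1 hP).1
  have hsin : 0 < Real.sin φ₀ :=
    Real.sin_pos_of_pos_of_lt_pi hφ.1 (by linarith [hφ.2, Real.pi_pos])
  have hcos : 0 < Real.cos φ₀ :=
    Real.cos_pos_of_mem_Ioo ⟨by linarith [hφ.1, Real.pi_pos], hφ.2⟩
  have htan : 0 < Real.tan φ₀ := Real.tan_pos_of_pos_of_lt_pi_div_two hφ.1 hφ.2
  have hm := G.m_pos
  have hI := G.I_pos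
  have habs : |deriv W F| =
      -(G.s Ω₀ / (2 * deriv G.M φ₀ * deriv G.s Ω₀)) * Real.tan φ₀ := by
    have hneg : G.s Ω₀ / (2 * deriv G.M φ₀ * deriv G.s Ω₀) < 0 :=
      div_neg_of_pos_of_neg hs0 (mul_neg_of_neg_of_pos (by linarith) hs)
    rw [hW.deriv, abs_of_neg (mul_neg_of_neg_of_pos hneg htan), neg_mul]
  refine ⟨hW.differentiableAt, habs, ?_⟩
  have hη : 0 < |deriv W F| := by
    rw [habs]
    refine mul_pos (neg_pos.2 (div_neg_of_pos_of_neg hs0 ?_)) htan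
    exact mul_neg_of_neg_of_pos (by linarith) hs
  -- Critical damping and non-uniformity are reciprocal up to the factor m / I, which makes the
  -- Vyshnegradskii condition a rearrangement of the damping inequality.
  have hcrit : G.criticalDamping φ₀ Ω₀ = G.m / (G.I * |deriv W F|) := by
    rw [habs, WattGovernor.criticalDamping, Real.cot_eq_cos_div_sin, Real.tan_eq_sin_div_cos]
    have := hM.ne
    field_simp
  rw [hcrit, div_lt_iff₀ (by positivity), div_mul_eq_mul_div, one_lt_div hm, mul_assoc]
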